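/- For a finite group $G$ and a subgroup $H \le G$, let $m_G(H) = |H|\cdot|\mathbf{C}_G(H)|$ be the Chermak--Delgado measure of $H$. Let $\mathcal{S}(G)$ be the set of all subgroups of $G$, ordered by inclusion. Call $m_G$ increasing on $\mathcal{S}(G)$ if $m_G(H) \le m_G(K)$ for all subgroups $H \le K$ of $G$. **Corollary.** Let $G$ be a finite group. Then $m_G$ is increasing on $\mathcal{S}(G)$ if and only if $G \cong P_1 \times \cdots \times P_n$ for some $n \ge 0$, distinct primes $p_1, \dots, p_n$ and groups $P_1, \dots, P_n$ such that, for each $i$, $P_i$ is a $p_i$-group and there is an element $a_i \in P_i$ with $P_i' = \langle a_i \rangle$ and $[a_i, P_i] \le \langle a_i^4 \rangle$. Here $P_i'$ is the derived subgroup of $P_i$, and $[a_i, P_i]$ is the subgroup generated by the commutators $[a_i, g]$ with $g \in P_i$. (For $n = 0$ the product is the trivial group.) -/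

import Mathlib

universe u

open scoped commutatorElement

/-- The Chermak--Delgado measure `m_G(H) = |H| * |C_G(H)|` of a subgroup `H` of `G`. -/
noncomputable def chermakDelgadoMeasure (G : Type u) [Group G] (H : Subgroup G) : ℕ :=
  Nat.card H * Nat.card (Subgroup.centralizer (H : Set G))

/-- The subgroup `[a, G]` generated by all the commutators `[a, g]` with `g` in `G`. -/
def elementCommutator {G : Type u} [Group G] (a : G) : Subgroup G :=
  Subgroup.closure (Set.range fun g : G => ⁅a, g⁆)

/-- Cheng's condition: the derived subgroup `G' = ⟨a⟩` is cyclic and `[a, G] ≤ ⟨a ^ 4⟩`. -/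
def ChengCondition (G : Type u) [Group G] : Prop :=
  ∃ a : G, commutator G = Subgroup.zpowers a ∧
    elementCommutator a ≤ Subgroup.zpowers (a ^ 4)

section Measure

variable {G : Type u} [Group G]

theorem Subgroup.relIndex_ne_zero_of_finite [Finite G] (H K : Subgroup G) : H.relIndex K ≠ 0 :=
  fun h => (Nat.card_pos (α := K)).ne' (Nat.eq_zero_of_zero_dvd (h ▸ H.relIndex_dvd_card K))

theorem Subgroup.mem_of_pow_mem_of_coprime {H : Subgroup G} {x : G} {m n : ℕ}
    (hmn : m.Coprime n) (hm : x ^ m ∈ H) (hn : x ^ n ∈ H) : x ∈ H := by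
  have h1 := Nat.gcd_eq_gcd_ab m n
  rw [hmn] at h1
  have h2 : x = (x ^ m) ^ (m.gcdA n) * (x ^ n) ^ (m.gcdB n) := by
    rw [← zpow_natCast, ← zpow_natCast, ← zpow_mul, ← zpow_mul, ← zpow_add, ← h1]
    simp
  rw [h2]
  exact H.mul_mem (H.zpow_mem hm _) (H.zpow_mem hn _)

theorem monotone_chermakDelgadoMeasure_iff [Finite G] :
    Monotone (chermakDelgadoMeasure G) ↔ ∀ H K : Subgroup G, H ≤ K →
      (Subgroup.centralizer (K : Set G)).relIndex (Subgroup.centralizer (H : Set G)) ≤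
        H.relIndex K := by
  refine forall₂_congr fun H K => forall_congr' fun h => ?_
  have hC : Subgroup.centralizer (K : Set G) ≤ Subgroup.centralizer (H : Set G) :=
    Subgroup.centralizer_le h
  have h1 : Nat.card H * H.relIndex K = Nat.card K := by
    simpa using Subgroup.relIndex_mul_relIndex ⊥ H K bot_le h
  have h2 := Subgroup.relIndex_mul_relIndex ⊥ _ _ bot_le hC
  rw [Subgroup.relIndex_bot_left, Subgroup.relIndex_bot_left] at h2
  unfold chermakDelgadoMeasure
  rw [← h1, ← h2]
  have p1 : 0 < Nat.card H * Nat.card (Subgroup.centralizer (K : Set G)) :=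
    Nat.mul_pos Nat.card_pos Nat.card_pos
  constructor
  · intro h
    refine le_of_mul_le_mul_left ?_ p1
    linarith
  · intro h
    have := Nat.mul_le_mul_left (Nat.card H * Nat.card (Subgroup.centralizer (K : Set G))) h
    linarith

theorem monotone_chermakDelgadoMeasure_of_injective [Finite G] {K : Type*} [Group K]
    (hG : Monotone (chermakDelgadoMeasure G)) (f : K →* G) (hf : Function.Injective f) :
    Monotone (chermakDelgadoMeasure K) := by
  have : Finite K := Finite.of_injective f hf
  rw [monotone_chermakDelgadoMeasure_iff] at hG ⊢
  intro H L hHL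
  have key : ∀ M : Subgroup K, Subgroup.centralizer (M : Set K) =
      (Subgroup.centralizer (M.map f : Set G)).comap f := by
    intro M
    ext k
    simp only [Subgroup.mem_comap, Subgroup.mem_centralizer_iff, Subgroup.coe_map,
      Set.forall_mem_image, ← map_mul, hf.eq_iff]
  calc _ = (Subgroup.centralizer (L.map f : Set G)).relIndex
        ((Subgroup.centralizer (H : Set K)).map f) := by
          rw [key L, Subgroup.relIndex_comap]
    _ ≤ (Subgroup.centralizer (L.map f : Set G)).relIndex
        (Subgroup.centralizer (H.map f : Set G)) := by
          refine Subgroup.relIndex_le_of_le_right ?_ (Subgroup.relIndex_ne_zero_of_finite _ _)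
          rw [key H]
          exact Subgroup.map_comap_le _ _
    _ ≤ _ := hG _ _ (Subgroup.map_mono hHL)
    _ = _ := Subgroup.relIndex_map_map_of_injective _ _ hf

/-- If `p` is prime, `x ^ p ∈ H` and `x ∉ H`, then `H` has index at least `p` in every subgroup
containing `x`. -/
theorem Subgroup.prime_le_relIndex [Finite G] {H K : Subgroup G} {x : G} {p : ℕ} (hp : p.Prime)
    (hxK : x ∈ K) (hx : x ∉ H) (hxp : x ^ p ∈ H) : p ≤ H.relIndex K := by
  by_contra! hlt
  obtain ⟨n, hn, hle, hmem⟩ := Subgroup.exists_pow_mem_of_relIndex_ne_zero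
    (Subgroup.relIndex_ne_zero_of_finite H K) hxK
  exact hx (Subgroup.mem_of_pow_mem_of_coprime
    (Nat.coprime_of_lt_prime hn.ne' (hle.trans_lt hlt) hp).symm hmem.1 hxp)

theorem Subgroup.exists_prime_pow_mem [Finite G] {H K : Subgroup G} (h : H < K) :
    ∃ (p k : ℕ) (x : G), p.Prime ∧ x ∈ K ∧ x ∉ H ∧ x ^ p ∈ H ∧ x ^ p ^ k = 1 := by
  classical
  obtain ⟨y, hyK, hyH⟩ := SetLike.exists_of_lt h
  have hex : ∃ n, 0 < n ∧ y ^ n ∈ H := ⟨orderOf y, orderOf_pos y, by simp⟩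
  set n := Nat.find hex with hn
  obtain ⟨hn0, hnH⟩ := Nat.find_spec hex
  have hn1 : n ≠ 1 := fun h1 => hyH (by rw [← hn, h1, pow_one] at hnH; exact hnH)
  obtain ⟨p, hp, q, hq⟩ := Nat.exists_prime_and_dvd hn1
  have hq0 : 0 < q := by
    rcases Nat.eq_zero_or_pos q with h0 | h0
    · rw [h0, mul_zero] at hq; omega
    · exact h0
  have hzH : y ^ q ∉ H := fun hmem => Nat.find_min hex
    (show q < n by rw [hq]; nlinarith [hp.two_le]) ⟨hq0, hmem⟩
  have hzp : (y ^ q) ^ p ∈ H := by rw [← pow_mul, mul_comm, ← hq]; exact hnH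
  set z := y ^ q
  obtain ⟨k, m, hm, hord⟩ := Nat.exists_eq_pow_mul_and_not_dvd (orderOf_pos z).ne' p hp.ne_one
  refine ⟨p, k, z ^ m, hp, K.pow_mem (K.pow_mem hyK _) _, fun hmem => hzH ?_, ?_, ?_⟩
  · exact Subgroup.mem_of_pow_mem_of_coprime ((Nat.Prime.coprime_iff_not_dvd hp).2 hm).symm
      hmem hzp
  · rw [← pow_mul, mul_comm, pow_mul]; exact H.pow_mem hzp _
  · rw [← pow_mul, mul_comm, ← hord, pow_orderOf_eq_one]

/-- A criterion for the Chermak--Delgado measure to be monotone: whenever a `p`-element `x`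
satisfies `x ^ p ∈ H` and `x ∉ H`, the centralizer of `x` has index at most `p` in `C(H)`. -/
theorem monotone_chermakDelgadoMeasure_of_forall [Finite G]
    (h : ∀ (H : Subgroup G) (x : G) (p k : ℕ), p.Prime → x ∉ H → x ^ p ∈ H → x ^ p ^ k = 1 →
      ∃ (α : Type u) (f : G → α) (S : Finset α), S.card ≤ p ∧
        (∀ c ∈ Subgroup.centralizer (H : Set G), f c ∈ S) ∧
        ∀ c ∈ Subgroup.centralizer (H : Set G), ∀ d ∈ Subgroup.centralizer (H : Set G),
          f c = f d → Commute (c⁻¹ * d) x) :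
    Monotone (chermakDelgadoMeasure G) := by
  intro H K hHK
  induction H using WellFoundedGT.induction with
  | ind H ih =>
    rcases hHK.eq_or_lt with rfl | hlt
    · rfl
    obtain ⟨p, k, x, hp, hxK, hxH, hxp, hxk⟩ := Subgroup.exists_prime_pow_mem hlt
    set L := H ⊔ Subgroup.zpowers x
    have hxL : x ∈ L := Subgroup.mem_sup_right (Subgroup.mem_zpowers x)
    have hHL : H < L := SetLike.lt_iff_le_and_exists.2 ⟨le_sup_left, x, hxL, hxH⟩
    refine le_trans ?_ (ih L hHL (sup_le hlt.le (by simpa using hxK)))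
    have h2 : p ≤ H.relIndex L := Subgroup.prime_le_relIndex hp hxL hxH hxp
    obtain ⟨α, f, S, hS, hfS, hf⟩ := h H x p k hp hxH hxp hxk
    set C := Subgroup.centralizer (H : Set G)
    have h3 : (Subgroup.centralizer (L : Set G)).relIndex C ≤ p := by
      refine le_trans ?_ hS
      rw [Subgroup.relIndex, Subgroup.index, ← Nat.card_eq_finsetCard S]
      refine Nat.card_le_card_of_injective
        (fun q : C ⧸ (Subgroup.centralizer (L : Set G)).subgroupOf C =>
          (⟨f (q.out : C), hfS _ (q.out : C).2⟩ : S)) fun q r hqr => ?_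
      have hqr := hf _ (q.out).2 _ (r.out).2 (congrArg Subtype.val hqr)
      rw [← Quotient.out_eq' q, ← Quotient.out_eq' r]
      refine QuotientGroup.eq.2 ?_
      rw [Subgroup.mem_subgroupOf]
      have hle : L ≤ Subgroup.centralizer {((q.out : C)⁻¹ * (r.out : C) : G)} := by
        refine sup_le (fun h hh => ?_) ?_
        · have := C.mul_mem (C.inv_mem (q.out).2) (r.out).2
          rw [Subgroup.mem_centralizer_singleton_iff]
          exact Subgroup.mem_centralizer_iff.1 this h hh
        · rw [Subgroup.zpowers_le, Subgroup.mem_centralizer_singleton_iff]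
          exact hqr.symm.eq
      exact Subgroup.mem_centralizer_iff.2 fun h hh =>
        Subgroup.mem_centralizer_singleton_iff.1 (hle hh)
    have hC : Subgroup.centralizer (L : Set G) ≤ C := Subgroup.centralizer_le hHL.le
    have e1 : Nat.card H * H.relIndex L = Nat.card L := by
      simpa using Subgroup.relIndex_mul_relIndex ⊥ H L bot_le hHL.le
    have e2 := Subgroup.relIndex_mul_relIndex ⊥ _ _ bot_le hC
    rw [Subgroup.relIndex_bot_left, Subgroup.relIndex_bot_left] at e2
    unfold chermakDelgadoMeasure
    rw [← e1, ← e2, mul_comm (Nat.card _) (Subgroup.relIndex _ _), ← mul_assoc]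
    exact Nat.mul_le_mul_right _ (Nat.mul_le_mul_left _ (h3.trans h2))

theorem relIndex_centralizer_pow_le [Finite G] (hG : Monotone (chermakDelgadoMeasure G)) (x : G)
    {n : ℕ} (hn : 0 < n) :
    (Subgroup.centralizer {x}).relIndex (Subgroup.centralizer {x ^ n}) ≤ n := by
  have h := monotone_chermakDelgadoMeasure_iff.1 hG (Subgroup.zpowers (x ^ n))
    (Subgroup.zpowers x) (by simp)
  rw [Subgroup.zpowers_eq_closure, Subgroup.zpowers_eq_closure, Subgroup.centralizer_closure,
    Subgroup.centralizer_closure] at h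
  refine h.trans ?_
  rw [← Subgroup.zpowers_eq_closure, ← Subgroup.zpowers_eq_closure]
  have := Subgroup.relIndex_mul_relIndex ⊥ (Subgroup.zpowers (x ^ n)) (Subgroup.zpowers x)
    bot_le (by simp)
  rw [Subgroup.relIndex_bot_left, Subgroup.relIndex_bot_left, Nat.card_zpowers,
    Nat.card_zpowers] at this
  by_contra! hlt
  have h1 : (orderOf (x ^ n)) * n < orderOf x := by
    rw [← this]; exact Nat.mul_lt_mul_of_pos_left hlt (orderOf_pos _)
  have h2 : x ^ (n * orderOf (x ^ n)) = 1 := by rw [pow_mul, pow_orderOf_eq_one]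
  have := Nat.le_of_dvd (Nat.mul_pos hn (orderOf_pos _)) (orderOf_dvd_of_pow_eq_one h2)
  linarith

end Measure

section PGroup

variable {G : Type u} [Group G] {p : ℕ}

theorem Subgroup.pow_prime_pow_mem [Finite G] (hp : p.Prime) (hG : IsPGroup p G)
    {H K : Subgroup G} {b : G} {m : ℕ} (h : H.relIndex K ≤ p ^ m) (hb : b ∈ K) :
    b ^ p ^ m ∈ H := by
  obtain ⟨n, hn, hle, hmem⟩ := Subgroup.exists_pow_mem_of_relIndex_ne_zero
    (Subgroup.relIndex_ne_zero_of_finite H K) hb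
  obtain ⟨j, u, hu, rfl⟩ := Nat.exists_eq_pow_mul_and_not_dvd hn.ne' p hp.ne_one
  obtain ⟨r, hr⟩ := (isPGroup_iff_pow_pow_eq_one.1 hG) (b ^ p ^ j)
  have hcop : u.Coprime (p ^ r) :=
    Nat.Coprime.pow_right _ ((Nat.Prime.coprime_iff_not_dvd hp).2 hu).symm
  have h1 : b ^ p ^ j ∈ H := Subgroup.mem_of_pow_mem_of_coprime hcop
    (by rw [← pow_mul]; exact hmem.1) (by rw [hr]; exact H.one_mem)
  have hu0 : 0 < u := Nat.pos_of_ne_zero fun h0 => hu (h0 ▸ dvd_zero p)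
  have hj : j ≤ m := (Nat.pow_le_pow_iff_right hp.one_lt).1
    ((Nat.le_mul_of_pos_right _ hu0).trans (hle.trans h))
  rw [← Nat.sub_add_cancel hj, add_comm, pow_add, pow_mul]
  exact H.pow_mem h1 _

theorem mem_centralizer_singleton_iff_commute {x y : G} :
    y ∈ Subgroup.centralizer {x} ↔ Commute x y := by
  rw [Subgroup.mem_centralizer_singleton_iff, commute_iff_eq, eq_comm]

theorem centralizer_singleton_eq_top {x : G} (hx : x ∈ Subgroup.center G) :
    Subgroup.centralizer {x} = ⊤ := by
  simpa using hx

theorem index_centralizer_le [Finite G] (hM : Monotone (chermakDelgadoMeasure G)) {x : G} {n : ℕ}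
    (hn : 0 < n) (hx : x ^ n ∈ Subgroup.center G) : (Subgroup.centralizer {x}).index ≤ n := by
  have := relIndex_centralizer_pow_le hM x hn
  rwa [centralizer_singleton_eq_top hx, Subgroup.relIndex_top_right] at this

theorem centralizer_centralizer_of_center_le [Finite G] (hM : Monotone (chermakDelgadoMeasure G))
    {K : Subgroup G} (hK : Subgroup.center G ≤ K) :
    Subgroup.centralizer (Subgroup.centralizer (K : Set G) : Set G) = K := by
  have key : ∀ L : Subgroup G, Subgroup.center G ≤ L →
      chermakDelgadoMeasure G L = Nat.card G * Nat.card (Subgroup.center G) := by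
    intro L hL
    refine le_antisymm ((hM (le_top : L ≤ ⊤)).trans_eq ?_) (Eq.trans_le ?_ (hM hL))
    · simp [chermakDelgadoMeasure, Subgroup.centralizer_univ]
    · simp [chermakDelgadoMeasure, mul_comm]
  have h1 := key K hK
  have h2 := key (Subgroup.centralizer (K : Set G)) (Subgroup.center_le_centralizer _)
  rw [← h1, chermakDelgadoMeasure, chermakDelgadoMeasure, mul_comm] at h2
  have h3 := Nat.eq_of_mul_eq_mul_right Nat.card_pos h2
  exact (Subgroup.eq_of_le_of_card_ge (Subgroup.le_centralizer_iff.1 le_rfl) h3.le).symm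

theorem exists_eq_zpow_mul_of_centralizer_le [Finite G] (hM : Monotone (chermakDelgadoMeasure G))
    {x y : G} (h : Subgroup.centralizer {x} ≤ Subgroup.centralizer {y}) :
    ∃ i : ℤ, ∃ z ∈ Subgroup.center G, y = x ^ i * z := by
  have h1 := centralizer_centralizer_of_center_le hM
    (le_sup_right : Subgroup.center G ≤ Subgroup.zpowers x ⊔ Subgroup.center G)
  have h2 : y ∈ Subgroup.zpowers x ⊔ Subgroup.center G := by
    rw [← h1, Subgroup.mem_centralizer_iff]
    intro c hc
    have hc' : c ∈ Subgroup.centralizer {x} := by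
      refine Subgroup.centralizer_le ?_ hc
      simpa using Subgroup.mem_sup_left (Subgroup.mem_zpowers x)
    exact (mem_centralizer_singleton_iff_commute.1 (h hc')).symm.eq
  obtain ⟨a, ⟨i, rfl⟩, z, hz, rfl⟩ := Subgroup.mem_sup_of_normal_right.1 h2
  exact ⟨i, z, hz, rfl⟩

/-- In a `p`-group, an element acts on a cyclic subgroup by an exponent congruent to `1`. -/
theorem IsPGroup.dvd_sub_one_of_conj_eq_zpow (hp : p.Prime) (hG : IsPGroup p G) {g x : G} {i : ℤ}
    (hx : x ≠ 1) (h : g * x * g⁻¹ = x ^ i) : (p : ℤ) ∣ i - 1 := by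
  have : Fact p.Prime := ⟨hp⟩
  obtain ⟨r, hr⟩ := (isPGroup_iff_pow_pow_eq_one.1 hG) g
  have key : ∀ n : ℕ, g ^ n * x * (g ^ n)⁻¹ = x ^ i ^ n := by
    intro n
    induction n with
    | zero => simp
    | succ n ih =>
      calc _ = g * (g ^ n * x * (g ^ n)⁻¹) * g⁻¹ := by rw [pow_succ' g]; group
        _ = _ := by rw [ih, ← conj_zpow, h, ← zpow_mul, pow_succ' i]
  have h1 := key (p ^ r)
  rw [hr] at h1
  have h2 : x ^ (i ^ p ^ r - 1) = 1 := by
    rw [zpow_sub, ← h1]; simp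
  have h3 : (p : ℤ) ∣ i ^ p ^ r - 1 :=
    (Int.natCast_dvd_natCast.2 (hG.dvd_orderOf hx)).trans (orderOf_dvd_iff_zpow_eq_one.2 h2)
  rw [← ZMod.intCast_zmod_eq_zero_iff_dvd] at h3 ⊢
  push_cast at h3 ⊢
  rwa [ZMod.pow_card_pow] at h3

theorem commutatorElement_mem_center [Finite G] (hp : p.Prime) (hG : IsPGroup p G)
    (hM : Monotone (chermakDelgadoMeasure G)) {x : G} (hx : x ^ p ∈ Subgroup.center G) (g : G) :
    ⁅x, g⁆ ∈ Subgroup.center G := by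
  have : Fact p.Prime := ⟨hp⟩
  by_cases hxZ : x ∈ Subgroup.center G
  · rw [commutatorElement_eq_one_iff_commute.2 (Subgroup.mem_center_iff.1 hxZ g).symm]
    exact Subgroup.one_mem _
  have hle := index_centralizer_le hM hp.pos hx
  have hnormal : (Subgroup.centralizer {x}).Normal := by
    obtain ⟨j, hj⟩ := hG.index (Subgroup.centralizer {x})
    rcases Nat.eq_zero_or_pos j with rfl | hj0
    · exact Subgroup.normal_of_index_eq_one (by simpa using hj)
    · have h1 : (Subgroup.centralizer {x}).index = p := by
        refine le_antisymm hle ?_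
        rw [hj]
        exact Nat.le_self_pow hj0.ne' p
      refine Subgroup.normal_of_index_eq_minFac_card ?_
      obtain ⟨n, hn⟩ := IsPGroup.iff_card.1 hG
      have hn0 : n ≠ 0 := by
        rintro rfl
        have := Subgroup.index_dvd_card (Subgroup.centralizer {x})
        rw [h1, hn, pow_zero, Nat.dvd_one] at this
        exact hp.ne_one this
      rw [h1, hn, hp.pow_minFac hn0]
  have h2 : Subgroup.centralizer {x} ≤ Subgroup.centralizer {g * x * g⁻¹} := by
    intro c hc
    have := hnormal.conj_mem c hc g⁻¹
    rw [mem_centralizer_singleton_iff_commute] at this ⊢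
    have := congrArg (fun t => g * t * g⁻¹) this.eq
    simpa [commute_iff_eq, mul_assoc] using this
  obtain ⟨i, z, hz, hi⟩ := exists_eq_zpow_mul_of_centralizer_le hM h2
  let π := QuotientGroup.mk' (Subgroup.center G)
  have hπ : ∀ t, π t = 1 ↔ t ∈ Subgroup.center G := fun t => QuotientGroup.eq_one_iff t
  have h3 : π g * π x * (π g)⁻¹ = π x ^ i := by
    rw [← map_mul, ← map_inv, ← map_mul, hi, map_mul, (hπ z).2 hz, mul_one, map_zpow]
  have h4 := (hG.to_quotient (Subgroup.center G)).dvd_sub_one_of_conj_eq_zpow hp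
    (fun h => hxZ ((hπ x).1 h)) h3
  obtain ⟨j, hj⟩ := h4
  have h5 : π x ^ i = π x := by
    rw [eq_add_of_sub_eq hj, zpow_add, zpow_mul, zpow_natCast, ← map_pow, (hπ _).2 hx]
    simp
  rw [← hπ, map_commutatorElement, commutatorElement_eq_one_iff_commute, commute_iff_eq]
  rw [h5] at h3
  exact (mul_inv_eq_iff_eq_mul.1 h3).symm

theorem commutatorElement_pow_eq_one [Finite G] (hp : p.Prime) (hG : IsPGroup p G)
    (hM : Monotone (chermakDelgadoMeasure G)) {x : G} (hx : x ^ p ∈ Subgroup.center G) (g : G) :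
    ⁅x, g⁆ ^ p = 1 := by
  have h1 := Subgroup.mem_center_iff.1 (commutatorElement_mem_center hp hG hM hx g)
  have h2 : g * x * g⁻¹ = ⁅x, g⁆⁻¹ * x := by rw [commutatorElement_def]; group
  have h3 : (g * x * g⁻¹) ^ p = (⁅x, g⁆⁻¹) ^ p * x ^ p := by
    rw [h2]; exact Commute.mul_pow (Commute.inv_left (h1 x).symm) p
  rw [conj_pow, Subgroup.mem_center_iff.1 hx g, mul_inv_cancel_right, inv_pow] at h3
  simpa using h3

/-- Commutation with `x` as a homomorphism, when all the commutators `⁅x, g⁆` are central. -/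
def commutatorHom (x : G) (h : ∀ g, ⁅x, g⁆ ∈ Subgroup.center G) : G →* G where
  toFun g := ⁅x, g⁆
  map_one' := commutatorElement_one_right x
  map_mul' g k := by
    have := Subgroup.mem_center_iff.1 (h k) g
    calc ⁅x, g * k⁆ = ⁅x, g⁆ * (g * ⁅x, k⁆ * g⁻¹) := by simp only [commutatorElement_def]; group
      _ = _ := by rw [this, mul_inv_cancel_right]

theorem commutatorElement_mem_zpowers_of_ne_one [Finite G] (hp : p.Prime) (hG : IsPGroup p G)
    (hM : Monotone (chermakDelgadoMeasure G)) {x : G} (hx : x ^ p ∈ Subgroup.center G) {h : G}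
    (hxh : ⁅x, h⁆ ≠ 1) (g : G) : ⁅x, g⁆ ∈ Subgroup.zpowers ⁅x, h⁆ := by
  have : Fact p.Prime := ⟨hp⟩
  let φ := commutatorHom x (commutatorElement_mem_center hp hG hM hx)
  have hφ : ∀ g, φ g = ⁅x, g⁆ := fun _ => rfl
  have hker : φ.ker = Subgroup.centralizer {x} := by
    ext g
    rw [MonoidHom.mem_ker, hφ, commutatorElement_eq_one_iff_commute,
      mem_centralizer_singleton_iff_commute]
  have hcard : Nat.card φ.range ≤ p := by
    rw [← Subgroup.index_ker, hker]
    exact index_centralizer_le hM hp.pos hx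
  have hle : Subgroup.zpowers ⁅x, h⁆ ≤ φ.range := by
    rw [Subgroup.zpowers_le]; exact ⟨h, rfl⟩
  have hord : orderOf ⁅x, h⁆ = p :=
    orderOf_eq_prime (commutatorElement_pow_eq_one hp hG hM hx h) hxh
  rw [Subgroup.eq_of_le_of_card_ge hle (by rwa [Nat.card_zpowers, hord])]
  exact ⟨g, rfl⟩

theorem commutatorElement_mul_left_of_commute {x y g : G} (h : Commute y g) :
    ⁅x * y, g⁆ = ⁅x, g⁆ := by
  have := h.eq
  calc ⁅x * y, g⁆ = x * (y * g) * y⁻¹ * x⁻¹ * g⁻¹ := by simp only [commutatorElement_def]; group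
    _ = _ := by rw [this, commutatorElement_def]; group

theorem index_centralizer_eq [Finite G] (hp : p.Prime) (hG : IsPGroup p G)
    (hM : Monotone (chermakDelgadoMeasure G)) {x : G} (hx : x ^ p ∈ Subgroup.center G)
    (hxZ : x ∉ Subgroup.center G) : (Subgroup.centralizer {x}).index = p := by
  have : Fact p.Prime := ⟨hp⟩
  refine le_antisymm (index_centralizer_le hM hp.pos hx) ?_
  obtain ⟨j, hj⟩ := hG.index (Subgroup.centralizer {x})
  rcases Nat.eq_zero_or_pos j with rfl | hj0
  · rw [pow_zero, Subgroup.index_eq_one] at hj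
    exact absurd (by simpa using hj) hxZ
  · rw [hj]
    exact Nat.le_self_pow hj0.ne' p

/-- All the commutators `⁅y, g⁆` with `y` of order at most `p` modulo the center lie in a common
subgroup of order `p`. -/
theorem commutatorElement_mem_zpowers [Finite G] (hp : p.Prime) (hG : IsPGroup p G)
    (hM : Monotone (chermakDelgadoMeasure G)) {x y : G} (hx : x ^ p ∈ Subgroup.center G)
    (hy : y ^ p ∈ Subgroup.center G) {h : G} (hxh : ⁅x, h⁆ ≠ 1) (g : G) :
    ⁅y, g⁆ ∈ Subgroup.zpowers ⁅x, h⁆ := by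
  have aux := fun g => commutatorElement_mem_zpowers_of_ne_one hp hG hM hx hxh g
  have notMem : ∀ {t k : G}, ⁅t, k⁆ ≠ 1 → t ∉ Subgroup.center G := fun htk ht =>
    htk (commutatorElement_eq_one_iff_commute.2 (Subgroup.mem_center_iff.1 ht _).symm)
  by_cases hyg : ⁅y, g⁆ = 1
  · rw [hyg]; exact Subgroup.one_mem _
  by_cases hle : Subgroup.centralizer {x} ≤ Subgroup.centralizer {y}
  · obtain ⟨i, z, hz, rfl⟩ := exists_eq_zpow_mul_of_centralizer_le hM hle
    rw [commutatorElement_mul_left_of_commute (Subgroup.mem_center_iff.1 hz g).symm]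
    have hc := Subgroup.mem_center_iff.1 (commutatorElement_mem_center hp hG hM hx g)
    have h1 : ⁅x ^ i, g⁆ = ⁅x, g⁆ ^ i := by
      have h2 : g * x * g⁻¹ = ⁅x, g⁆⁻¹ * x := by rw [commutatorElement_def]; group
      have h3 : (g * x * g⁻¹) ^ i = (⁅x, g⁆⁻¹) ^ i * x ^ i := by
        rw [h2]; exact Commute.mul_zpow (Commute.inv_left (hc x).symm) i
      rw [conj_zpow, inv_zpow] at h3
      calc ⁅x ^ i, g⁆ = x ^ i * (g * x ^ i * g⁻¹)⁻¹ := by rw [commutatorElement_def]; group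
        _ = _ := by rw [h3]; group
    rw [h1]
    exact Subgroup.zpow_mem _ (aux g) i
  by_cases hle' : Subgroup.centralizer {y} ≤ Subgroup.centralizer {x}
  · refine absurd (Eq.ge ?_) hle
    have h1 := Subgroup.relIndex_mul_index hle'
    rw [index_centralizer_eq hp hG hM hx (notMem hxh),
      index_centralizer_eq hp hG hM hy (notMem hyg)] at h1
    exact hle'.antisymm (Subgroup.relIndex_eq_one.1 (Nat.eq_of_mul_eq_mul_right hp.pos
      (h1.trans (one_mul p).symm)))
  obtain ⟨a, hax, hay⟩ := SetLike.not_le_iff_exists.1 hle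
  obtain ⟨b, hby, hbx⟩ := SetLike.not_le_iff_exists.1 hle'
  rw [mem_centralizer_singleton_iff_commute] at hax hay hby hbx
  rw [← commutatorElement_eq_one_iff_commute] at hay hbx
  have hcom : ∀ k : G, ⁅x * y, k⁆ = ⁅x, k⁆ * ⁅y, k⁆ := by
    intro k
    have hc := Subgroup.mem_center_iff.1 (commutatorElement_mem_center hp hG hM hy k) x
    calc ⁅x * y, k⁆ = (x * ⁅y, k⁆) * x⁻¹ * ⁅x, k⁆ := by
          simp only [commutatorElement_def]; group
      _ = ⁅y, k⁆ * ⁅x, k⁆ := by rw [hc, mul_inv_cancel_right]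
      _ = _ := (Subgroup.mem_center_iff.1 (commutatorElement_mem_center hp hG hM hy k) _).symm
  have hxy : (x * y) ^ p ∈ Subgroup.center G := by
    have hc : ∀ k : G, ⁅x * y, k⁆ ∈ Subgroup.center G := fun k => by
      rw [hcom]
      exact Subgroup.mul_mem _ (commutatorElement_mem_center hp hG hM hx k)
        (commutatorElement_mem_center hp hG hM hy k)
    rw [Subgroup.mem_center_iff]
    intro k
    have h2 : k * (x * y) * k⁻¹ = ⁅x * y, k⁆⁻¹ * (x * y) := by rw [commutatorElement_def]; group
    have h3 : (k * (x * y) * k⁻¹) ^ p = (⁅x * y, k⁆⁻¹) ^ p * (x * y) ^ p := by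
      rw [h2]
      exact Commute.mul_pow (Commute.inv_left (Subgroup.mem_center_iff.1 (hc k) _).symm) p
    have h4 : ⁅x * y, k⁆ ^ p = 1 := by
      rw [hcom, Commute.mul_pow, commutatorElement_pow_eq_one hp hG hM hx,
        commutatorElement_pow_eq_one hp hG hM hy, mul_one]
      exact Subgroup.mem_center_iff.1 (commutatorElement_mem_center hp hG hM hy k) _
    rw [conj_pow, inv_pow, h4, inv_one, one_mul] at h3
    exact mul_inv_eq_iff_eq_mul.1 h3
  have h1 : ⁅x * y, b⁆ = ⁅x, b⁆ := by
    rw [hcom, commutatorElement_eq_one_iff_commute.2 hby, mul_one]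
  have h2 : ⁅x * y, a⁆ = ⁅y, a⁆ := by
    rw [hcom, commutatorElement_eq_one_iff_commute.2 hax, one_mul]
  have h3 := commutatorElement_mem_zpowers_of_ne_one hp hG hM hxy (h := b) (by rwa [h1]) a
  rw [h1, h2] at h3
  have h4 := commutatorElement_mem_zpowers_of_ne_one hp hG hM hy hay g
  exact (Subgroup.zpowers_le.2 ((Subgroup.zpowers_le.2 (aux b)) h3)) h4

end PGroup

section Commutators

variable {G : Type u} [Group G] {p : ℕ}

theorem mem_center_of_closure_eq_top {x b u : G} (h : Subgroup.closure {x, b} = ⊤)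
    (hx : Commute u x) (hb : Commute u b) : u ∈ Subgroup.center G := by
  have h1 : Subgroup.closure {x, b} ≤ Subgroup.centralizer {u} := by
    rw [Subgroup.closure_le]
    rintro t (rfl | rfl)
    · exact mem_centralizer_singleton_iff_commute.2 hx
    · exact mem_centralizer_singleton_iff_commute.2 hb
  rw [h] at h1
  exact Subgroup.mem_center_iff.2 fun g =>
    (mem_centralizer_singleton_iff_commute.1 (h1 (Subgroup.mem_top g))).symm.eq

theorem not_commute_pow_of_closure_eq_top [Finite G] (hp : p.Prime) (hG : IsPGroup p G)
    (hM : Monotone (chermakDelgadoMeasure G)) {x b : G} {k : ℕ}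
    (h : Subgroup.closure {x, b} = ⊤) (h1 : Commute (x ^ p ^ (k + 1)) b)
    (h2 : ¬ Commute (x ^ p ^ k) b) :
    ¬ Commute x (b ^ p ^ k) ∧ b ^ p ^ (k + 1) ∈ Subgroup.center G := by
  have key : ∀ {u v : G} {m : ℕ}, u ^ p ^ m ∈ Subgroup.center G → Commute u (v ^ p ^ m) := by
    intro u v m hu
    have := index_centralizer_le hM (pow_pos hp.pos m) hu
    rw [← Subgroup.relIndex_top_right] at this
    exact mem_centralizer_singleton_iff_commute.1
      (Subgroup.pow_prime_pow_mem hp hG this (Subgroup.mem_top v))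
  refine ⟨fun hc => h2 ?_, ?_⟩
  · exact (key (mem_center_of_closure_eq_top h hc.symm ((Commute.refl b).pow_left _))).symm
  · exact mem_center_of_closure_eq_top h
      (key (mem_center_of_closure_eq_top h ((Commute.refl x).pow_left _) h1)).symm
      ((Commute.refl b).pow_left _)

theorem commutatorElement_mem_zpowers_of_pow_commute [Finite G] (hp : p.Prime)
    (hG : IsPGroup p G) (hM : Monotone (chermakDelgadoMeasure G)) {x₀ g₀ : G}
    (h₀ : x₀ ^ p ∈ Subgroup.center G) (hne : ⁅x₀, g₀⁆ ≠ 1) {x y : G} (hxy : Commute (x ^ p) y) :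
    ⁅x, y⁆ ∈ Subgroup.zpowers ⁅x₀, g₀⁆ := by
  classical
  set N := Subgroup.zpowers ⁅x₀, g₀⁆
  have hNc : N ≤ Subgroup.center G :=
    Subgroup.zpowers_le.2 (commutatorElement_mem_center hp hG hM h₀ g₀)
  have hNn : N.Normal := ⟨fun n hn g => by
    rw [Subgroup.mem_center_iff.1 (hNc hn) g, mul_inv_cancel_right]; exact hn⟩
  by_cases hxZ : x ∈ Subgroup.center G
  · rw [commutatorElement_eq_one_iff_commute.2 (Subgroup.mem_center_iff.1 hxZ y).symm]
    exact N.one_mem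
  have hex : ∃ k, x ^ p ^ k ∈ Subgroup.center G := by
    obtain ⟨k, hk⟩ := (isPGroup_iff_pow_pow_eq_one.1 hG) x
    exact ⟨k, hk ▸ Subgroup.one_mem _⟩
  obtain ⟨k, hk⟩ : ∃ k, Nat.find hex = k + 1 := Nat.exists_eq_succ_of_ne_zero fun h0 => hxZ (by
    have := Nat.find_spec hex
    rwa [h0, pow_zero, pow_one] at this)
  have hk1 : x ^ p ^ (k + 1) ∈ Subgroup.center G := hk ▸ Nat.find_spec hex
  have hk2 : x ^ p ^ k ∉ Subgroup.center G := Nat.find_min hex (by omega)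
  obtain ⟨b, hb⟩ : ∃ b, ¬ Commute (x ^ p ^ k) b := by
    by_contra! hall
    exact hk2 (Subgroup.mem_center_iff.2 fun g => (hall g).symm.eq)
  have hwN : ⁅x ^ p ^ k, b⁆ ∈ N := commutatorElement_mem_zpowers hp hG hM h₀
    (by rw [← pow_mul, ← pow_succ]; exact hk1) hne b
  have hb' : ¬ Commute x (b ^ p ^ k) ∧ ⁅b ^ p ^ k, x⁆ ∈ Subgroup.zpowers ⁅x ^ p ^ k, b⁆ ∧
      Commute x (b ^ p ^ (k + 1)) := by
    let T := Subgroup.closure {x, b}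
    let X : T := ⟨x, Subgroup.subset_closure (by simp)⟩
    let B : T := ⟨b, Subgroup.subset_closure (by simp)⟩
    have hT : Subgroup.closure {X, B} = ⊤ := by
      rw [← Subgroup.closure_closure_coe_preimage (k := {x, b})]
      congr 1
      ext t
      simp [X, B, Subtype.ext_iff]
    have hTM := monotone_chermakDelgadoMeasure_of_injective hM T.subtype T.subtype_injective
    have hTp := hG.to_subgroup T
    have hcoe : ∀ {u v : T}, Commute u v ↔ Commute (u : G) (v : G) := fun {u v} => by
      simp [commute_iff_eq, Subtype.ext_iff]
    have hX : Commute (X ^ p ^ (k + 1)) B :=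
      hcoe.2 (Subgroup.mem_center_iff.1 hk1 b).symm
    obtain ⟨c1, c2⟩ := not_commute_pow_of_closure_eq_top hp hTp hTM hT hX
      (fun h => hb (hcoe.1 h))
    have c3 := commutatorElement_mem_zpowers hp hTp hTM (x := X ^ p ^ k) (y := B ^ p ^ k) (h := B)
      (by
        rw [← pow_mul, ← pow_succ]
        exact mem_center_of_closure_eq_top hT ((Commute.refl X).pow_left _) hX)
      (by rw [← pow_mul, ← pow_succ]; exact c2)
      (fun h => hb (hcoe.1 (commutatorElement_eq_one_iff_commute.1 h))) X
    refine ⟨fun h => c1 (hcoe.2 h), ?_, hcoe.1 (Subgroup.mem_center_iff.1 c2 X)⟩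
    obtain ⟨i, hi⟩ := c3
    exact ⟨i, congrArg Subtype.val hi⟩
  obtain ⟨hbx, hbN, hbp⟩ := hb'
  set d := b ^ p ^ k
  have hdN : ⁅d, x⁆ ∈ N := Subgroup.zpowers_le.2 hwN hbN
  have hdp : d ^ p ∈ Subgroup.centralizer {x} := by
    rw [mem_centralizer_singleton_iff_commute, ← pow_mul, ← pow_succ]; exact hbp
  have hNp : ∀ n ∈ N, n ^ p = 1 := by
    rintro _ ⟨i, rfl⟩
    change (_ ^ i) ^ p = _
    rw [← zpow_natCast, zpow_comm, zpow_natCast, commutatorElement_pow_eq_one hp hG hM h₀,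
      one_zpow]
  have hxd : Commute (x ^ p) d := by
    have h1 : d * x * d⁻¹ = ⁅d, x⁆ * x := by rw [commutatorElement_def]; group
    have h2 : (d * x * d⁻¹) ^ p = ⁅d, x⁆ ^ p * x ^ p := by
      rw [h1]; exact Commute.mul_pow (Subgroup.mem_center_iff.1 (hNc hdN) x).symm p
    rw [conj_pow, hNp _ hdN, one_mul] at h2
    exact (mul_inv_eq_iff_eq_mul.1 h2).symm
  let π := QuotientGroup.mk' N
  have hπ : ∀ t, π t = 1 ↔ t ∈ N := fun t => QuotientGroup.eq_one_iff t
  let M := Subgroup.centralizer {x ^ p} ⊓ (Subgroup.centralizer {π x}).comap π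
  have hMmem : ∀ c, c ∈ M ↔ Commute (x ^ p) c ∧ ⁅x, c⁆ ∈ N := by
    intro c
    rw [Subgroup.mem_inf, Subgroup.mem_comap, mem_centralizer_singleton_iff_commute,
      mem_centralizer_singleton_iff_commute, ← commutatorElement_eq_one_iff_commute (g₁ := π x),
      ← map_commutatorElement, hπ]
  have hdM : d ∈ M := (hMmem d).2 ⟨hxd, by rw [← commutatorElement_inv]; exact N.inv_mem hdN⟩
  have hle : Subgroup.centralizer {x} ≤ M := fun c hc => by
    rw [mem_centralizer_singleton_iff_commute] at hc
    exact (hMmem c).2 ⟨hc.pow_left p,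
      by rw [commutatorElement_eq_one_iff_commute.2 hc]; exact N.one_mem⟩
  have e1 := relIndex_centralizer_pow_le hM x hp.pos
  have e2 : p ≤ (Subgroup.centralizer {x}).relIndex M := Subgroup.prime_le_relIndex hp hdM
    (fun h => hbx (mem_centralizer_singleton_iff_commute.1 h)) hdp
  rw [← Subgroup.relIndex_mul_relIndex _ M _ hle inf_le_left] at e1
  have e3 : M.relIndex (Subgroup.centralizer {x ^ p}) = 1 := by
    have := Nat.pos_of_ne_zero
      (Subgroup.relIndex_ne_zero_of_finite M (Subgroup.centralizer {x ^ p}))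
    have hp0 := hp.pos
    nlinarith
  exact ((hMmem y).1 (Subgroup.relIndex_eq_one.1 e3
    (mem_centralizer_singleton_iff_commute.2 hxy))).2

theorem pow_mul_mul_pow_inv_of_conj {x y c : G} (hx : Commute c x) (hb : Commute c ⁅x, y⁆)
    (h : x * ⁅x, y⁆ * x⁻¹ = c * ⁅x, y⁆) (n : ℕ) :
    x ^ n * y * (x ^ n)⁻¹ = c ^ (n * (n - 1) / 2) * ⁅x, y⁆ ^ n * y := by
  induction n with
  | zero => simp
  | succ n ih =>
    have h1 : x * c ^ (n * (n - 1) / 2) * x⁻¹ = c ^ (n * (n - 1) / 2) := by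
      rw [← (hx.pow_left _).eq, mul_inv_cancel_right]
    have h2 : x * ⁅x, y⁆ ^ n * x⁻¹ = c ^ n * ⁅x, y⁆ ^ n := by
      rw [← conj_pow, h, hb.mul_pow]
    have h3 : (n + 1) * (n + 1 - 1) / 2 = n * (n - 1) / 2 + n := by
      rw [← Finset.sum_range_id_mul_two, ← Finset.sum_range_id_mul_two,
        Nat.mul_div_cancel _ two_pos, Nat.mul_div_cancel _ two_pos, Finset.sum_range_succ]
    calc x ^ (n + 1) * y * (x ^ (n + 1))⁻¹ = x * (x ^ n * y * (x ^ n)⁻¹) * x⁻¹ := by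
          rw [pow_succ' x]; group
      _ = (x * c ^ (n * (n - 1) / 2) * x⁻¹) * (x * ⁅x, y⁆ ^ n * x⁻¹) * (x * y * x⁻¹) := by
          rw [ih]; group
      _ = c ^ (n * (n - 1) / 2) * (c ^ n * ⁅x, y⁆ ^ n) * (⁅x, y⁆ * y) := by
          rw [h1, h2]; simp [commutatorElement_def]
      _ = _ := by rw [h3, pow_add, pow_succ ⁅x, y⁆]; simp only [mul_assoc]

/-- Every commutator of order `p` lies in a common central subgroup of order `p`. -/
theorem commutatorElement_mem_zpowers_of_pow_eq_one [Finite G] (hp : p.Prime)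
    (hG : IsPGroup p G) (hM : Monotone (chermakDelgadoMeasure G)) {x₀ g₀ : G}
    (h₀ : x₀ ^ p ∈ Subgroup.center G) (hne : ⁅x₀, g₀⁆ ≠ 1) {x y : G} (hxy : ⁅x, y⁆ ^ p = 1) :
    ⁅x, y⁆ ∈ Subgroup.zpowers ⁅x₀, g₀⁆ := by
  have F := fun {x y : G} (h : Commute (x ^ p) y) =>
    commutatorElement_mem_zpowers_of_pow_commute hp hG hM h₀ hne h
  set b := ⁅x, y⁆ with hb
  have hbZ : b ^ p ∈ Subgroup.center G := hxy ▸ Subgroup.one_mem _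
  have hcen := fun g => commutatorElement_mem_center hp hG hM hbZ g
  have hpow := fun g => commutatorElement_pow_eq_one hp hG hM hbZ g
  have hconj : ∀ g, g * b * g⁻¹ = ⁅b, g⁆⁻¹ * b := fun g => by
    rw [commutatorElement_def]; group
  have hcomm : ∀ g k, Commute ⁅b, g⁆⁻¹ k := fun g k =>
    Commute.inv_left (Subgroup.mem_center_iff.1 (hcen g) k).symm
  rcases hp.eq_two_or_odd with rfl | hodd
  · have hsq : ∀ {u v : G}, u * ⁅u, v⁆ * u⁻¹ * ⁅u, v⁆ = 1 → Commute (u ^ 2) v := by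
      intro u v h
      rw [← commutatorElement_eq_one_iff_commute, ← h]
      simp only [commutatorElement_def, sq]; group
    have hbb : b * b = 1 := by rw [← sq]; exact hxy
    by_cases hbx : ⁅b, x⁆ = 1
    · exact F (hsq (by rw [← hb, hconj, hbx, inv_one, one_mul, hbb]))
    by_cases hby : ⁅b, y⁆ = 1
    · rw [hb, ← commutatorElement_inv y x]
      refine Subgroup.inv_mem _ (F (hsq ?_))
      have h2 := hconj y
      rw [hby, inv_one, one_mul] at h2
      have h3 := congrArg (·⁻¹) h2
      rw [← commutatorElement_inv x y, ← hb]
      simp only [mul_inv_rev, inv_inv] at h3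
      rw [mul_assoc y, h3, ← mul_inv_rev, hbb, inv_one]
    have heq : ⁅b, x⁆ = ⁅b, y⁆ := by
      obtain ⟨i, hi⟩ := commutatorElement_mem_zpowers_of_ne_one hp hG hM hbZ hby x
      change _ ^ i = _ at hi
      have h2 : ⁅b, y⁆ ^ (2 : ℤ) = 1 := by exact_mod_cast hpow y
      rcases Int.even_or_odd' i with ⟨j, rfl | rfl⟩
      · rw [zpow_mul, h2, one_zpow] at hi
        exact absurd hi.symm hbx
      · rw [zpow_add, zpow_mul, h2, one_zpow, one_mul, zpow_one] at hi
        exact hi.symm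
    have hxyb : ⁅x * y, y⁆ = b := by
      rw [commutatorElement_mul_left_of_commute (Commute.refl y)]
    have := F (x := x * y) (y := y) (hsq (by
      rw [hxyb]
      calc x * y * b * (x * y)⁻¹ * b = x * (y * b * y⁻¹) * x⁻¹ * b := by group
        _ = ⁅b, y⁆⁻¹ * (x * b * x⁻¹) * b := by
          rw [hconj y, ← mul_assoc x, ← (hcomm y x).eq]; group
        _ = (⁅b, y⁆ ^ 2)⁻¹ * (b * b) := by rw [hconj x, heq, sq]; group
        _ = 1 := by rw [hpow, hbb]; simp))
    rwa [hxyb] at this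
  · refine F ?_
    have h1 := pow_mul_mul_pow_inv_of_conj (hcomm x x) (hcomm x b) (hconj x) p
    have h2 : p * (p - 1) / 2 = p * ((p - 1) / 2) := by
      apply Nat.mul_div_assoc; omega
    rw [h2, pow_mul, inv_pow, hpow, inv_one, one_pow, ← hb, hxy, one_mul, one_mul] at h1
    exact mul_inv_eq_iff_eq_mul.1 h1

end Commutators

section Cheng

variable {G : Type u} [Group G] {p : ℕ}

theorem commutatorElement_mem_commutator (x y : G) : ⁅x, y⁆ ∈ commutator G :=
  Subgroup.commutator_mem_commutator (Subgroup.mem_top x) (Subgroup.mem_top y)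

theorem ChengCondition.exists_conj_eq_zpow (h : ChengCondition G) (g : G) :
    ∃ k : ℤ, ∀ z ∈ commutator G, g * z * g⁻¹ = z ^ (1 + 4 * k) := by
  obtain ⟨a, ha, ha4⟩ := h
  obtain ⟨k, hk⟩ := ha4 (Subgroup.subset_closure ⟨g, rfl⟩)
  change (a ^ 4) ^ k = a * g * a⁻¹ * g⁻¹ at hk
  have h1 : g * a * g⁻¹ = a ^ (1 + 4 * (-k)) := by
    calc g * a * g⁻¹ = (a * g * a⁻¹ * g⁻¹)⁻¹ * a := by group
      _ = _ := by
        rw [← hk, ← zpow_natCast, ← zpow_mul, ← zpow_neg, ← zpow_add_one]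
        congr 1
        push_cast
        ring
  refine ⟨-k, fun z hz => ?_⟩
  rw [ha] at hz
  obtain ⟨i, rfl⟩ := hz
  change g * a ^ i * g⁻¹ = (a ^ i) ^ _
  rw [← conj_zpow, h1, zpow_comm]

theorem IsPGroup.zpowers_zpow_eq (hp : p.Prime) (hG : IsPGroup p G) (c : G) {i : ℤ}
    (hi : ¬ (p : ℤ) ∣ i) : Subgroup.zpowers (c ^ i) = Subgroup.zpowers c := by
  refine le_antisymm (Subgroup.zpowers_le.2 ⟨i, rfl⟩) (Subgroup.zpowers_le.2 ?_)
  obtain ⟨r, hr⟩ := (isPGroup_iff_pow_pow_eq_one.1 hG) c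
  have hcop : IsCoprime i ((p : ℤ) ^ r) :=
    ((Nat.prime_iff_prime_int.1 hp).coprime_iff_not_dvd.2 hi).symm.pow_right
  obtain ⟨u, v, huv⟩ := hcop
  refine ⟨u, ?_⟩
  change (c ^ i) ^ u = c
  have h1 : c ^ (v * (p : ℤ) ^ r) = 1 := by
    rw [mul_comm, zpow_mul, ← Nat.cast_pow, zpow_natCast, hr, one_zpow]
  rw [← zpow_mul, mul_comm i u]
  calc c ^ (u * i) = c ^ (u * i + v * (p : ℤ) ^ r) := by rw [zpow_add, h1, mul_one]
    _ = c := by rw [huv, zpow_one]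

theorem exists_geom_sum_eq (hp : p.Prime) {s k : ℤ} (hs : s = 1 + 4 * k)
    (hps : (p : ℤ) ∣ s - 1) : ∃ u : ℤ, ∑ j ∈ Finset.range p, s ^ j = p * (1 + p * u) := by
  rcases hp.eq_two_or_odd' with rfl | hodd
  · refine ⟨k, ?_⟩
    rw [Finset.sum_range_succ, Finset.sum_range_one, hs]
    push_cast
    ring
  · obtain ⟨t, ht⟩ := hps
    obtain ⟨u, hu⟩ := odd_sq_dvd_geom_sum₂_sub (1 : ℤ) t hodd
    refine ⟨u, ?_⟩
    simp only [one_pow, mul_one, ← ht] at hu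
    rw [add_sub_cancel] at hu
    linear_combination hu

theorem pow_conj_eq_zpow_geom_sum {x y : G} {s : ℤ} (h : x * ⁅x, y⁆ * x⁻¹ = ⁅x, y⁆ ^ s) (n : ℕ) :
    ⁅x ^ n, y⁆ = ⁅x, y⁆ ^ ∑ j ∈ Finset.range n, s ^ j := by
  induction n with
  | zero => simp
  | succ n ih =>
    calc ⁅x ^ (n + 1), y⁆ = x * ⁅x ^ n, y⁆ * x⁻¹ * ⁅x, y⁆ := by
          simp only [commutatorElement_def, pow_succ' x]; group
      _ = _ := by
        rw [ih, ← conj_zpow, h, ← zpow_mul, Finset.mul_sum, ← zpow_add_one, Finset.sum_range_succ']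
        simp only [pow_succ', pow_zero]

theorem ChengCondition.zpowers_commutatorElement_pow (hp : p.Prime) (hG : IsPGroup p G)
    (h : ChengCondition G) (x y : G) :
    Subgroup.zpowers ⁅x ^ p, y⁆ = Subgroup.zpowers (⁅x, y⁆ ^ p) := by
  obtain ⟨k, hk⟩ := h.exists_conj_eq_zpow x
  have hb := hk _ (commutatorElement_mem_commutator x y)
  rw [pow_conj_eq_zpow_geom_sum hb]
  by_cases h1 : ⁅x, y⁆ = 1
  · simp [h1]
  obtain ⟨u, hu⟩ := exists_geom_sum_eq hp rfl (hG.dvd_sub_one_of_conj_eq_zpow hp h1 hb)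
  rw [hu, zpow_mul, zpow_natCast, hG.zpowers_zpow_eq hp]
  intro hdvd
  have : (p : ℤ) ∣ 1 := (Int.dvd_add_left (dvd_mul_right _ u)).1 hdvd
  exact hp.one_lt.ne' (by exact_mod_cast Int.eq_one_of_dvd_one (by positivity) this)

theorem ChengCondition.zpowers_commutatorElement_pow_pow (hp : p.Prime) (hG : IsPGroup p G)
    (h : ChengCondition G) (x y : G) (n : ℕ) :
    Subgroup.zpowers ⁅x ^ p ^ n, y⁆ = Subgroup.zpowers (⁅x, y⁆ ^ p ^ n) := by
  induction n with
  | zero => simp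
  | succ n ih =>
    have key : ∀ {a b : G}, Subgroup.zpowers a = Subgroup.zpowers b →
        Subgroup.zpowers (a ^ p) = Subgroup.zpowers (b ^ p) := by
      intro a b hab
      have : ∀ {a b : G}, Subgroup.zpowers a = Subgroup.zpowers b →
          Subgroup.zpowers (a ^ p) ≤ Subgroup.zpowers (b ^ p) := by
        intro a b hab
        obtain ⟨i, hi⟩ : a ∈ Subgroup.zpowers b := hab ▸ Subgroup.mem_zpowers a
        refine Subgroup.zpowers_le.2 ⟨i, ?_⟩
        change (b ^ p) ^ i = a ^ p
        rw [← hi, ← zpow_natCast, ← zpow_natCast, zpow_comm]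
      exact le_antisymm (this hab) (this hab.symm)
    rw [pow_succ, pow_mul, h.zpowers_commutatorElement_pow hp hG, pow_mul]
    exact key ih

theorem IsPGroup.exists_zpowers_commutatorElement_eq (hp : p.Prime) (hG : IsPGroup p G) {a : G}
    (ha : commutator G = Subgroup.zpowers a) : ∃ x y : G, commutator G = Subgroup.zpowers ⁅x, y⁆ := by
  have : Fact p.Prime := ⟨hp⟩
  by_cases h1 : a = 1
  · exact ⟨1, 1, by rw [ha, h1]; simp⟩
  by_contra! hne
  have hle : commutator G ≤ Subgroup.zpowers (a ^ p) := by
    rw [commutator_eq_closure, Subgroup.closure_le]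
    rintro _ ⟨x, y, rfl⟩
    obtain ⟨i, hi⟩ : ⁅x, y⁆ ∈ Subgroup.zpowers a := ha ▸ commutatorElement_mem_commutator x y
    change a ^ i = _ at hi
    by_cases hpi : (p : ℤ) ∣ i
    · obtain ⟨j, rfl⟩ := hpi
      exact ⟨j, by rw [← hi, zpow_mul, zpow_natCast]⟩
    · exact absurd (by rw [← hi, hG.zpowers_zpow_eq hp a hpi, ha]) (hne x y)
  obtain ⟨j, hj⟩ := hle (ha ▸ Subgroup.mem_zpowers a)
  change (a ^ p) ^ j = a at hj
  have h2 : a ^ (p * j - 1) = 1 := by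
    rw [zpow_sub, zpow_mul, zpow_natCast, hj, zpow_one, mul_inv_cancel]
  have h3 : (p : ℤ) ∣ p * j - 1 :=
    (Int.natCast_dvd_natCast.2 (hG.dvd_orderOf h1)).trans (orderOf_dvd_iff_zpow_eq_one.2 h2)
  have h4 : (p : ℤ) ∣ 1 := (Int.dvd_iff_dvd_of_dvd_sub h3).1 (dvd_mul_right _ j)
  exact hp.one_lt.ne' (by exact_mod_cast Int.eq_one_of_dvd_one (by positivity) h4)

theorem monotone_chermakDelgadoMeasure_quotient [Finite G] (hp : p.Prime) (hG : IsPGroup p G)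
    {N : Subgroup G} [N.Normal] (hN : Nat.card N ≤ p)
    (hcomm : ∀ x y : G, Commute (x ^ p) y → ⁅x, y⁆ ∈ N) :
    Monotone (chermakDelgadoMeasure (G ⧸ N)) := by
  classical
  have : Fact p.Prime := ⟨hp⟩
  refine monotone_chermakDelgadoMeasure_of_forall fun H x q k hq hx hxq hxk => ?_
  have hqp : q = p := by
    have h1 : x ≠ 1 := fun h => hx (h ▸ H.one_mem)
    have h2 := (hG.to_quotient N).dvd_orderOf h1
    exact ((Nat.prime_dvd_prime_iff_eq hp hq).1
      (hp.dvd_of_dvd_pow (h2.trans (orderOf_dvd_of_pow_eq_one hxk)))).symm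
  subst hqp
  have := Fintype.ofFinite N
  obtain ⟨w, rfl⟩ := QuotientGroup.mk'_surjective N x
  let π := QuotientGroup.mk' N
  have hπ : ∀ t, π t = 1 ↔ t ∈ N := fun t => QuotientGroup.eq_one_iff t
  have hout : ∀ c : G ⧸ N, π c.out = c := fun c => QuotientGroup.out_eq' c
  refine ⟨G, fun c => ⁅c.out, w ^ q⁆, (N : Set G).toFinset, ?_, ?_, ?_⟩
  · rw [Set.toFinset_card, ← Nat.card_eq_fintype_card]
    exact hN
  · intro c hc
    rw [Set.mem_toFinset, SetLike.mem_coe, ← hπ, map_commutatorElement, hout, map_pow,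
      commutatorElement_eq_one_iff_commute]
    exact (Subgroup.mem_centralizer_iff.1 hc _ hxq).symm
  · intro c _ d _ hcd
    have h1 : Commute (w ^ q) (c.out⁻¹ * d.out) := by
      change c.out * w ^ q * c.out⁻¹ * (w ^ q)⁻¹ = d.out * w ^ q * d.out⁻¹ * (w ^ q)⁻¹ at hcd
      have h2 := mul_right_cancel hcd
      rw [commute_iff_eq]
      calc w ^ q * (c.out⁻¹ * d.out) = c.out⁻¹ * (c.out * w ^ q * c.out⁻¹) * d.out := by group
        _ = _ := by rw [h2]; group
    have h3 := hcomm _ _ h1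
    rw [← hπ, map_commutatorElement, commutatorElement_eq_one_iff_commute, map_mul, map_inv, hout,
      hout] at h3
    exact h3.symm

theorem ChengCondition.of_conj_eq_zpow {a : G} (ha : commutator G = Subgroup.zpowers a)
    (h : ∀ g : G, ⁅a, g⁆ ∈ Subgroup.zpowers (a ^ 4)) : ChengCondition G := by
  refine ⟨a, ha, ?_⟩
  rw [elementCommutator, Subgroup.closure_le]
  rintro _ ⟨g, rfl⟩
  exact h g

/-- If every element centralizes or inverts a generator of the derived subgroup, then (under the
other assumptions) that generator is central. -/
theorem commute_of_conj_eq_or_eq_inv {a x y : G} {N : Subgroup G} (hxy : ⁅x, y⁆ = a)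
    (ha : commutator G = Subgroup.zpowers a) (haN : a ∉ N)
    (hconj : ∀ g : G, g * a * g⁻¹ = a ∨ g * a * g⁻¹ = a⁻¹)
    (hcomm : ∀ x y : G, Commute (x ^ 2) y → ⁅x, y⁆ ∈ N) (g : G) : Commute a g := by
  have F : ∀ u : G, u * a * u⁻¹ = a⁻¹ → ∀ v, ⁅u, v⁆ ∈ N := by
    intro u hu v
    obtain ⟨i, hi⟩ : ⁅u, v⁆ ∈ Subgroup.zpowers a := ha ▸ commutatorElement_mem_commutator u v
    change a ^ i = _ at hi
    refine hcomm u v ?_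
    have h1 : ⁅u ^ 2, v⁆ = u * ⁅u, v⁆ * u⁻¹ * ⁅u, v⁆ := by
      simp only [commutatorElement_def, sq]; group
    rw [← commutatorElement_eq_one_iff_commute, h1, ← hi, ← conj_zpow, hu, inv_zpow,
      inv_mul_cancel]
  rcases hconj g with hg | hg
  · rw [commute_iff_eq]
    exact (mul_inv_eq_iff_eq_mul.1 hg).symm
  exfalso
  rcases hconj x with hx | hx
  · have h1 := F (g * x) (by
      calc g * x * a * (g * x)⁻¹ = g * (x * a * x⁻¹) * g⁻¹ := by group
        _ = _ := by rw [hx, hg]) y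
    have h2 : ⁅g * x, y⁆ = a⁻¹ * ⁅g, y⁆ := by
      calc ⁅g * x, y⁆ = g * ⁅x, y⁆ * g⁻¹ * ⁅g, y⁆ := by
            simp only [commutatorElement_def]; group
        _ = _ := by rw [hxy, hg]
    rw [h2, Subgroup.mul_mem_cancel_right _ (F g hg y), Subgroup.inv_mem_iff] at h1
    exact haN h1
  · exact haN (hxy ▸ F x hx y)

theorem chengCondition_of_monotone (hp : p.Prime) (n : ℕ) : ∀ (G : Type u) [Group G] [Finite G],
    Nat.card G = n → IsPGroup p G → Monotone (chermakDelgadoMeasure G) → ChengCondition G := by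
  have : Fact p.Prime := ⟨hp⟩
  induction n using Nat.strong_induction_on with
  | _ n ih =>
  intro G _ _ hn hG hM
  by_cases htop : Subgroup.center G = ⊤
  · have h1 : ∀ x y : G, ⁅x, y⁆ = 1 := fun x y => by
      rw [commutatorElement_eq_one_iff_commute]
      exact Subgroup.mem_center_iff.1 (htop ▸ Subgroup.mem_top y) x
    refine ChengCondition.of_conj_eq_zpow (a := 1) ?_ fun g => by simp
    rw [commutator_eq_closure, Subgroup.zpowers_one_eq_bot, Subgroup.closure_eq_bot_iff]
    rintro _ ⟨x, y, rfl⟩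
    exact h1 x y
  obtain ⟨x₀, g₀, h₀, hne⟩ : ∃ x₀ g₀ : G, x₀ ^ p ∈ Subgroup.center G ∧ ⁅x₀, g₀⁆ ≠ 1 := by
    obtain ⟨q, k, x, hq, -, hx, hxq, hxk⟩ := Subgroup.exists_prime_pow_mem (lt_top_iff_ne_top.2 htop)
    have hqp : q = p := by
      have h2 := hG.dvd_orderOf (g := x) (fun h => hx (by rw [h]; exact Subgroup.one_mem _))
      exact ((Nat.prime_dvd_prime_iff_eq hp hq).1
        (hp.dvd_of_dvd_pow (h2.trans (orderOf_dvd_of_pow_eq_one hxk)))).symm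
    subst hqp
    rw [Subgroup.mem_center_iff] at hx
    push Not at hx
    obtain ⟨g, hg⟩ := hx
    exact ⟨x, g, hxq, fun h => hg (commutatorElement_eq_one_iff_commute.1 h).symm.eq⟩
  have F6 := fun x y (h : Commute (x ^ p) y) =>
    commutatorElement_mem_zpowers_of_pow_commute hp hG hM h₀ hne h
  have F7 := fun x y (h : ⁅x, y⁆ ^ p = 1) =>
    commutatorElement_mem_zpowers_of_pow_eq_one hp hG hM h₀ hne (x := x) (y := y) h
  have hncen := commutatorElement_mem_center hp hG hM h₀ g₀
  have hnp := commutatorElement_pow_eq_one hp hG hM h₀ g₀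
  have hnG := commutatorElement_mem_commutator x₀ g₀
  generalize ⁅x₀, g₀⁆ = n₀ at *
  set N := Subgroup.zpowers n₀ with hN
  have hNp : ∀ n ∈ N, n ^ p = 1 := by
    rintro _ ⟨i, rfl⟩
    change (_ ^ i) ^ p = _
    rw [← zpow_natCast, zpow_comm, zpow_natCast, hnp, one_zpow]
  have hNc : N ≤ Subgroup.center G := Subgroup.zpowers_le.2 hncen
  have hNn : N.Normal := ⟨fun n hn g => by
    rw [Subgroup.mem_center_iff.1 (hNc hn) g, mul_inv_cancel_right]; exact hn⟩
  have hNcard : Nat.card N = p := by rw [hN, Nat.card_zpowers]; exact orderOf_eq_prime hnp hne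
  have hNgen : ∀ m ∈ N, m ≠ 1 → N ≤ Subgroup.zpowers m := by
    intro m hm hm1
    refine (Subgroup.eq_of_le_of_card_ge (Subgroup.zpowers_le.2 hm) ?_).ge
    rw [hNcard, Nat.card_zpowers, orderOf_eq_prime (hNp m hm) hm1]
  let π := QuotientGroup.mk' N
  have hπ : ∀ t, π t = 1 ↔ t ∈ N := fun t => QuotientGroup.eq_one_iff t
  have hQp : IsPGroup p (G ⧸ N) := hG.to_quotient N
  have hQ : ChengCondition (G ⧸ N) := by
    refine ih (Nat.card (G ⧸ N)) ?_ _ rfl hQp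
      (monotone_chermakDelgadoMeasure_quotient hp hG hNcard.le F6)
    rw [← hn, Subgroup.card_eq_card_quotient_mul_card_subgroup N, hNcard]
    exact lt_mul_of_one_lt_right Nat.card_pos hp.one_lt
  obtain ⟨x, y, hxy⟩ : ∃ x y : G, commutator (G ⧸ N) = Subgroup.zpowers (π ⁅x, y⁆) := by
    obtain ⟨a, ha, -⟩ := hQ
    obtain ⟨X, Y, h⟩ := hQp.exists_zpowers_commutatorElement_eq hp ha
    obtain ⟨x, rfl⟩ := QuotientGroup.mk'_surjective N X
    obtain ⟨y, rfl⟩ := QuotientGroup.mk'_surjective N Y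
    exact ⟨x, y, by rw [map_commutatorElement]; exact h⟩
  obtain ⟨a, ha⟩ : ∃ a, a = ⁅x, y⁆ := ⟨_, rfl⟩
  have hπG : ∀ g ∈ commutator G, ∃ i : ℤ, ∃ m ∈ N, g = a ^ i * m := by
    have hle : commutator G ≤ (commutator (G ⧸ N)).comap π := by
      rw [commutator_eq_closure, Subgroup.closure_le]
      rintro _ ⟨u, v, rfl⟩
      rw [SetLike.mem_coe, Subgroup.mem_comap, map_commutatorElement]
      exact commutatorElement_mem_commutator _ _
    intro g hg
    have := hle hg
    rw [Subgroup.mem_comap, hxy, ← ha] at this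
    obtain ⟨i, hi⟩ := this
    change π a ^ i = π g at hi
    exact ⟨i, (a ^ i)⁻¹ * g, by rw [← hπ, map_mul, map_inv, map_zpow, hi, inv_mul_cancel],
      by group⟩
  by_cases haN : a ∈ N
  · refine ChengCondition.of_conj_eq_zpow (a := n₀) (le_antisymm ?_ (Subgroup.zpowers_le.2 hnG))
      fun g => ?_
    · intro g hg
      obtain ⟨i, m, hm, rfl⟩ := hπG g hg
      exact N.mul_mem (N.zpow_mem haN i) hm
    · rw [commutatorElement_eq_one_iff_commute.2 (Subgroup.mem_center_iff.1 hncen g).symm]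
      exact Subgroup.one_mem _
  have hπa : π a ≠ 1 := fun h => haN ((hπ a).1 h)
  obtain ⟨m, hm⟩ : ∃ m, orderOf (π a) = p ^ (m + 1) := by
    obtain ⟨m, hm⟩ := IsPGroup.iff_orderOf.1 hQp (π a)
    rcases m with _ | m
    · exact absurd (orderOf_eq_one_iff.1 (by simpa using hm)) hπa
    · exact ⟨m, hm⟩
  have hapN : a ^ p ^ (m + 1) ∈ N := by rw [← hπ, map_pow, ← hm, pow_orderOf_eq_one]
  have hap : a ^ p ^ (m + 1) ≠ 1 := by
    intro h1
    have hz := hQ.zpowers_commutatorElement_pow_pow hp hQp (π x) (π y) m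
    rw [← map_commutatorElement, ← map_pow, ← map_pow, ← map_commutatorElement, ← ha] at hz
    have hnot : ⁅x ^ p ^ m, y⁆ ∉ N := by
      intro hmem
      rw [(hπ _).2 hmem, Subgroup.zpowers_one_eq_bot, eq_comm, Subgroup.zpowers_eq_bot, map_pow,
        ← orderOf_dvd_iff_pow_eq_one, hm, Nat.pow_dvd_pow_iff_le_right hp.one_lt] at hz
      omega
    refine hnot (F7 _ _ ?_)
    obtain ⟨i, hi⟩ : π ⁅x ^ p ^ m, y⁆ ∈ Subgroup.zpowers (π (a ^ p ^ m)) :=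
      hz ▸ Subgroup.mem_zpowers _
    change π (a ^ p ^ m) ^ i = _ at hi
    have h2 : ((a ^ p ^ m) ^ i)⁻¹ * ⁅x ^ p ^ m, y⁆ ∈ N := by
      rw [← hπ, map_mul, map_inv, map_zpow, hi, inv_mul_cancel]
    have h3 : ⁅x ^ p ^ m, y⁆ =
        (a ^ p ^ m) ^ i * (((a ^ p ^ m) ^ i)⁻¹ * ⁅x ^ p ^ m, y⁆) := by group
    rw [h3, Commute.mul_pow (Subgroup.mem_center_iff.1 (hNc h2) _), hNp _ h2, mul_one,
      ← zpow_natCast, zpow_comm, zpow_natCast, ← pow_mul, ← pow_succ, h1, one_zpow]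
  have hNa' : N ≤ Subgroup.zpowers (a ^ p ^ (m + 1)) := hNgen _ hapN hap
  have hNa : N ≤ Subgroup.zpowers a :=
    hNa'.trans (Subgroup.zpowers_le.2 (Subgroup.npow_mem_zpowers a _))
  have hGa : commutator G = Subgroup.zpowers a := by
    refine le_antisymm (fun g hg => ?_)
      (Subgroup.zpowers_le.2 (ha ▸ commutatorElement_mem_commutator x y))
    obtain ⟨i, m, hm, rfl⟩ := hπG g hg
    exact Subgroup.mul_mem _ ⟨i, rfl⟩ (hNa hm)
  refine ChengCondition.of_conj_eq_zpow hGa fun g => ?_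
  rcases hp.eq_two_or_odd' with rfl | hodd
  swap
  · have h1 := hG.zpowers_zpow_eq hp a (i := 4) (by
      intro h
      have h2 : p ∣ 2 ^ 2 := by exact_mod_cast h
      have h3 := (Nat.prime_dvd_prime_iff_eq hp Nat.prime_two).1 (hp.dvd_of_dvd_pow h2)
      rw [h3] at hodd
      exact absurd hodd (by decide))
    have h2 : a ^ (4 : ℤ) = a ^ 4 := by exact_mod_cast zpow_natCast a 4
    rw [← h2, h1, ← hGa]
    exact commutatorElement_mem_commutator a g
  · have hconj : ∀ g : G, ∃ k : ℤ, ∃ n ∈ N, g * a * g⁻¹ = a ^ (1 + 4 * k) * n := by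
      intro g
      obtain ⟨k, hk⟩ := hQ.exists_conj_eq_zpow (π g)
      have := hk (π a) (by rw [ha, map_commutatorElement]; exact commutatorElement_mem_commutator _ _)
      refine ⟨k, (a ^ (1 + 4 * k))⁻¹ * (g * a * g⁻¹), ?_, by group⟩
      rw [← hπ, map_mul, map_inv, map_zpow, map_mul, map_mul, map_inv, this, inv_mul_cancel]
    rcases m with _ | m
    · have h4 : a ^ 4 = 1 := by
        have := hNp _ hapN
        rwa [← pow_mul] at this
      rw [commutatorElement_eq_one_iff_commute.2]
      · exact Subgroup.one_mem _
      refine commute_of_conj_eq_or_eq_inv ha.symm hGa haN (fun g => ?_) F6 g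
      obtain ⟨k, n, hn, hk⟩ := hconj g
      obtain ⟨i, hi⟩ := hNa' hn
      change (a ^ 2 ^ (0 + 1)) ^ i = n at hi
      have h4z : a ^ (4 : ℤ) = 1 := by exact_mod_cast h4
      rw [zpow_add, zpow_mul, h4z, one_zpow, mul_one, zpow_one, ← hi, ← zpow_natCast, ← zpow_mul] at hk
      rcases Int.even_or_odd' i with ⟨j, rfl | rfl⟩
      · left
        rw [hk]
        have : ((2 ^ (0 + 1) : ℕ) : ℤ) * (2 * j) = 4 * j := by push_cast; ring
        rw [this, zpow_mul, h4z, one_zpow, mul_one]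
      · right
        rw [hk, ← zpow_one_add]
        have : 1 + ((2 ^ (0 + 1) : ℕ) : ℤ) * (2 * j + 1) = 4 * (j + 1) - 1 := by push_cast; ring
        rw [this, zpow_sub, zpow_mul, h4z, one_zpow, one_mul, zpow_one]
    · obtain ⟨k, n, hn, hk⟩ := hconj g
      have h1 : ⁅a, g⁆ = ((a ^ (4 * k)) * n)⁻¹ := by
        calc ⁅a, g⁆ = a * (g * a * g⁻¹)⁻¹ := by rw [commutatorElement_def]; group
          _ = a * n⁻¹ * a⁻¹ * (a ^ (4 * k))⁻¹ := by rw [hk]; group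
          _ = _ := by
            rw [Subgroup.mem_center_iff.1 (Subgroup.inv_mem _ (hNc hn)) a]; group
      rw [h1]
      refine Subgroup.inv_mem _ (Subgroup.mul_mem _ ⟨k, ?_⟩ ?_)
      · change (a ^ 4) ^ k = _
        rw [zpow_mul]; norm_cast
      · refine Subgroup.zpowers_le.2 ?_ (hNa' hn)
        rw [show 2 ^ (m + 1 + 1) = 4 * 2 ^ m by ring, pow_mul]
        exact Subgroup.npow_mem_zpowers _ _

end Cheng

section Nilpotent

theorem Nat.coprime_of_le_of_minFac_dvd {n k d : ℕ} (hk : 0 < k) (hkp : k ≤ n.minFac) (hd : d ∣ n)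
    (hpd : ¬ n.minFac ∣ d) : k.Coprime d := by
  refine Nat.coprime_of_dvd fun q hq hqk hqd => ?_
  have h1 : n.minFac ≤ q := Nat.minFac_le_of_dvd hq.two_le (hqd.trans hd)
  have h2 := Nat.le_of_dvd hk hqk
  have h3 : q = n.minFac := by omega
  exact hpd (h3 ▸ hqd)

theorem commute_of_pow_minFac_pow_eq_one {G : Type u} [Group G] [Finite G]
    (hM : Monotone (chermakDelgadoMeasure G)) {y : G} (hy : ¬ (Nat.card G).minFac ∣ orderOf y)
    (k : ℕ) : ∀ x : G, x ^ (Nat.card G).minFac ^ k = 1 → Commute x y := by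
  induction k with
  | zero =>
    intro x hx
    rw [pow_zero, pow_one] at hx
    rw [hx]
    exact Commute.one_left y
  | succ k ih =>
    intro x hx
    have h1 : Commute (x ^ (Nat.card G).minFac) y := ih _ (by rw [← pow_mul, ← pow_succ']; exact hx)
    obtain ⟨n, hn, hle, hmem⟩ := Subgroup.exists_pow_mem_of_relIndex_ne_zero
      (Subgroup.relIndex_ne_zero_of_finite (Subgroup.centralizer {x})
        (Subgroup.centralizer {x ^ (Nat.card G).minFac}))
      (mem_centralizer_singleton_iff_commute.2 h1)
    have h2 := hle.trans (relIndex_centralizer_pow_le hM x (Nat.minFac_pos _))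
    exact mem_centralizer_singleton_iff_commute.1 (Subgroup.mem_of_pow_mem_of_coprime
      (Nat.coprime_of_le_of_minFac_dvd hn h2 (orderOf_dvd_natCard y) hy) hmem.1
      (by rw [pow_orderOf_eq_one]; exact Subgroup.one_mem _))

/-- A Sylow subgroup that is centralized by all the elements of order prime to `p` is normal. -/
theorem Sylow.normal_of_forall_commute {G : Type u} [Group G] [Finite G] {p : ℕ} [Fact p.Prime]
    (P : Sylow p G) (h : ∀ x ∈ P, ∀ y : G, ¬ p ∣ orderOf y → Commute x y) :
    (P : Subgroup G).Normal := by
  have hp : p.Prime := Fact.out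
  refine ⟨fun x hx g => ?_⟩
  have hle : ∀ z, ¬ p ∣ orderOf z → z ∈ Subgroup.normalizer (P : Set G) := fun z hz =>
    Subgroup.centralizer_le_normalizer _ (Subgroup.mem_centralizer_iff.2 fun x hx =>
      (h x hx z hz).eq)
  have htop : Subgroup.normalizer (P : Set G) = ⊤ := by
    rw [← Subgroup.index_eq_one]
    by_contra hne
    obtain ⟨q, hq, hqd⟩ := Nat.exists_prime_and_dvd hne
    have : Fact q.Prime := ⟨hq⟩
    obtain ⟨Q⟩ : Nonempty (Sylow q G) := inferInstance
    by_cases hqp : q = p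
    · subst hqp
      exact P.not_dvd_index (hqd.trans (Subgroup.index_dvd_of_le Subgroup.le_normalizer))
    · refine Q.not_dvd_index (hqd.trans (Subgroup.index_dvd_of_le fun z hz => hle z fun hpz => ?_))
      obtain ⟨j, hj⟩ := (isPGroup_iff_orderOf_dvd_pow.1 Q.isPGroup') ⟨z, hz⟩
      rw [← Subgroup.orderOf_coe] at hj
      exact hqp ((Nat.prime_dvd_prime_iff_eq hp hq).1 (hp.dvd_of_dvd_pow (hpz.trans hj))).symm
  have hg : g ∈ Subgroup.normalizer (P : Set G) := htop ▸ Subgroup.mem_top g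
  exact (Subgroup.mem_normalizer_iff.1 hg x).1 hx

theorem isNilpotent_of_monotone (n : ℕ) : ∀ (G : Type u) [Group G] [Finite G],
    Nat.card G = n → Monotone (chermakDelgadoMeasure G) → Group.IsNilpotent G := by
  induction n using Nat.strong_induction_on with
  | _ n ih =>
  intro G _ _ hn hM
  by_cases h1 : Nat.card G = 1
  · have := (Nat.card_eq_one_iff_unique.1 h1).1
    infer_instance
  set p := (Nat.card G).minFac with hp
  have hpp : p.Prime := Nat.minFac_prime h1
  have : Fact p.Prime := ⟨hpp⟩
  obtain ⟨P⟩ : Nonempty (Sylow p G) := inferInstance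
  have hcomm : ∀ x ∈ P, ∀ y : G, ¬ p ∣ orderOf y → Commute x y := by
    intro x hx y hy
    obtain ⟨k, hk⟩ := (isPGroup_iff_pow_pow_eq_one.1 P.isPGroup') ⟨x, hx⟩
    exact commute_of_pow_minFac_pow_eq_one hM hy k x (congrArg Subtype.val hk)
  have hPn : (P : Subgroup G).Normal := P.normal_of_forall_commute hcomm
  obtain ⟨Q, hQ⟩ := Subgroup.exists_right_complement'_of_coprime P.card_coprime_index
  have hQcard : Nat.card Q * Nat.card P = Nat.card G := by
    rw [mul_comm]; exact hQ.card_mul_card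
  have hpQ : ¬ p ∣ Nat.card Q := by
    rw [← hQ.symm.index_eq_card]
    exact P.not_dvd_index
  have hPcard : 1 < Nat.card P := by
    have : p ∣ Nat.card P := by
      have := Nat.minFac_dvd (Nat.card G)
      rw [← hp, ← hQcard] at this
      exact (hpp.dvd_mul.1 this).resolve_left hpQ
    exact hpp.one_lt.trans_le (Nat.le_of_dvd Nat.card_pos this)
  have hQnil : Group.IsNilpotent Q := by
    refine ih _ ?_ Q rfl (monotone_chermakDelgadoMeasure_of_injective hM Q.subtype
      Q.subtype_injective)
    rw [← hn, ← hQcard]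
    exact lt_mul_of_one_lt_right Nat.card_pos hPcard
  have hPnil : Group.IsNilpotent P := P.isPGroup'.isNilpotent
  have hPQ : ∀ (x : P) (y : Q), Commute ((P : Subgroup G).subtype x) (Q.subtype y) := fun x y =>
    hcomm x x.2 y fun h => hpQ (h.trans (by
      have := orderOf_dvd_natCard y
      rwa [← Subgroup.orderOf_coe] at this))
  have hφ : Function.Surjective (MonoidHom.noncommCoprod _ _ hPQ) := by
    rw [← MonoidHom.range_eq_top, MonoidHom.noncommCoprod_range, Subgroup.range_subtype,
      Subgroup.range_subtype]
    exact hQ.sup_eq_top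
  exact Group.nilpotent_of_surjective _ hφ

end Nilpotent

section Products

theorem ChengCondition.of_mulEquiv {G H : Type*} [Group G] [Group H] (e : G ≃* H)
    (h : ChengCondition G) : ChengCondition H := by
  obtain ⟨a, ha, h4⟩ := h
  have hcom : commutator H = (commutator G).map e.toMonoidHom := by
    rw [commutator_def, commutator_def, Subgroup.map_commutator, Subgroup.map_top_of_surjective _ e.surjective]
  refine ChengCondition.of_conj_eq_zpow (a := e a) ?_ fun g => ?_
  · rw [hcom, ha, MonoidHom.map_zpowers]; rfl
  · obtain ⟨i, hi⟩ := h4 (Subgroup.subset_closure ⟨e.symm g, rfl⟩)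
    refine ⟨i, ?_⟩
    have := congrArg e hi
    simpa using this

theorem monotone_chermakDelgadoMeasure_pi {ι : Type} [Finite ι] {p : ι → ℕ} {P : ι → Type u}
    [∀ i, Group (P i)] [∀ i, Finite (P i)] (hinj : Function.Injective p)
    (hp : ∀ i, (p i).Prime) (hP : ∀ i, IsPGroup (p i) (P i)) (hC : ∀ i, ChengCondition (P i)) :
    Monotone (chermakDelgadoMeasure ((i : ι) → P i)) := by
  classical
  refine monotone_chermakDelgadoMeasure_of_forall fun H x q k hq hx hxq hxk => ?_
  have hx1 : ∀ i, x i ≠ 1 → q = p i := by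
    intro i hi
    have : Fact (p i).Prime := ⟨hp i⟩
    have h2 : x i ^ q ^ k = 1 := congrFun hxk i
    exact ((Nat.prime_dvd_prime_iff_eq (hp i) hq).1 ((hp i).dvd_of_dvd_pow
      (((hP i).dvd_orderOf hi).trans (orderOf_dvd_of_pow_eq_one h2)))).symm
  obtain ⟨i, hi⟩ : ∃ i, x i ≠ 1 := by
    by_contra! h
    exact hx ((funext h : x = 1) ▸ H.one_mem)
  obtain rfl := hx1 i hi
  have hxj : ∀ j, j ≠ i → x j = 1 := fun j hj => by
    by_contra h
    exact hj (hinj (hx1 j h)).symm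
  obtain ⟨a, ha, -⟩ := id (hC i)
  have := Fintype.ofFinite (Subgroup.zpowers a)
  refine ⟨P i, fun c => ⁅x i, c i⁆,
    (Finset.univ.filter fun z : Subgroup.zpowers a => z ^ p i = 1).map
      (Function.Embedding.subtype _), ?_, ?_, ?_⟩
  · rw [Finset.card_map]
    exact IsCyclic.card_pow_eq_one_le (hp i).pos
  · intro c hc
    have hmem := commutatorElement_mem_commutator (x i) (c i)
    rw [ha] at hmem
    rw [Finset.mem_map]
    refine ⟨⟨_, hmem⟩, ?_, rfl⟩
    have h1 := congrFun (Subgroup.mem_centralizer_iff.1 hc _ hxq) i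
    have h2 := (hC i).zpowers_commutatorElement_pow (hp i) (hP i) (x i) (c i)
    rw [commutatorElement_eq_one_iff_commute.2 (show Commute (x i ^ p i) (c i) from h1),
      Subgroup.zpowers_one_eq_bot, eq_comm, Subgroup.zpowers_eq_bot] at h2
    simpa [Subtype.ext_iff] using h2
  · intro c _ d _ hcd
    funext j
    by_cases hj : j = i
    · subst hj
      change x j * c j * (x j)⁻¹ * (c j)⁻¹ = x j * d j * (x j)⁻¹ * (d j)⁻¹ at hcd
      change (c j)⁻¹ * d j * x j = x j * ((c j)⁻¹ * d j)
      have h1 := congrArg (fun t => (c j)⁻¹ * ((x j)⁻¹ * t)⁻¹ * d j) hcd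
      simpa [mul_assoc] using h1.symm
    · change (c j)⁻¹ * d j * x j = x j * ((c j)⁻¹ * d j)
      rw [hxj j hj, mul_one, one_mul]

end Products

theorem mainTheorem4 (G : Type u) [Group G] [Finite G] :
    Monotone (chermakDelgadoMeasure G) ↔
      ∃ (n : ℕ) (p : Fin n → ℕ) (P : Fin n → Type u) (_ : ∀ i, Group (P i)),
        Function.Injective p ∧
        (∀ i, (p i).Prime) ∧
        (∀ i, IsPGroup (p i) (P i)) ∧
        (∀ i, ChengCondition (P i)) ∧
        Nonempty (G ≃* ((i : Fin n) → P i)) := by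
  constructor
  · intro hM
    have hnil := isNilpotent_of_monotone _ G rfl hM
    have hnorm := (Group.isNilpotent_of_finite_tfae (G := G)).out 0 3 |>.1 hnil
    let e := Sylow.directProductOfNormal (G := G) fun {p} hp P => hnorm p hp P
    let s := (Nat.card G).primeFactors
    let f : Fin s.card ≃ s := s.equivFin.symm
    have hprime : ∀ i, ((f i : ℕ)).Prime := fun i => Nat.prime_of_mem_primeFactors (f i).2
    let P : ∀ i, Sylow (f i : ℕ) G := fun i => default
    have huniq : ∀ i, Subsingleton (Sylow (f i : ℕ) G) := fun i => by
      have : Fact ((f i : ℕ)).Prime := ⟨hprime i⟩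
      have := hnorm _ ⟨hprime i⟩ (P i)
      exact (Sylow.unique_of_normal (P i) this).instSubsingleton
    refine ⟨s.card, fun i => (f i : ℕ), fun i => ((Q : Sylow (f i : ℕ) G) → Q), inferInstance,
      fun i j h => f.injective (Subtype.ext h), hprime, ?_, ?_, ?_⟩
    · intro i
      have := Unique.mk' (Sylow (f i : ℕ) G)
      exact IsPGroup.of_equiv (Sylow.isPGroup' _)
        (MulEquiv.piUnique fun Q : Sylow (f i : ℕ) G => Q).symm
    · intro i
      have := Unique.mk' (Sylow (f i : ℕ) G)
      refine ChengCondition.of_mulEquiv (MulEquiv.piUnique fun Q : Sylow (f i : ℕ) G => Q).symm ?_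
      exact chengCondition_of_monotone (hprime i) _ _ rfl (Sylow.isPGroup' _)
        (monotone_chermakDelgadoMeasure_of_injective hM (Subgroup.subtype _)
          (Subgroup.subtype_injective _))
    · exact ⟨e.symm.trans
        { (Equiv.piCongrLeft (fun q : s => (Q : Sylow (q : ℕ) G) → Q) f).symm with
          map_mul' := fun _ _ => rfl }⟩
  · rintro ⟨n, p, P, _, hinj, hp, hP, hC, ⟨e⟩⟩
    have : Finite ((i : Fin n) → P i) := Finite.of_equiv G e.toEquiv
    have : ∀ i, Finite (P i) := fun i => Finite.of_surjective _ (Function.surjective_eval i)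
    exact monotone_chermakDelgadoMeasure_of_injective
      (monotone_chermakDelgadoMeasure_pi hinj hp hP hC) e.toMonoidHom e.injective
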